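/- Let $d\ge 1$, let $S^{d-1}$ be the unit sphere of $\mathbb R^d$ and $S^{d-1}_+=S^{d-1}\cap\mathbb R^d_+$ the set of its points with nonnegative coordinates. Let $\alpha\in[0,2)$, let $\lambda$ be a finite Borel measure on $S^{d-1}$ and $\beta:S^{d-1}\to(0,\infty)$ a Borel function. Let $\mu\sim\mathcal{E}T\alpha S(\alpha,\beta,\lambda)$, that is, $\mu$ is an infinitely divisible probability measure on $\mathbb R^d$ without Gaussian part and with Lévy measure $$\nu(E)=\int_{S^{d-1}}\int_0^\infty \mathbf 1_E(rw)\,\frac{e^{-\beta(w)r}}{r^{\alpha+1}}\,dr\,\lambda(dw).$$ Let $q>0$ and let $S=(S(t))_{t\ge 0}$ be a Sato subordinator with exponent $q$ associated with $\mu$: an additive process in $\mathbb R^d$ (that is, $S(0)=0$ a.s., with independent increments, stochastically continuous, with a.s. càdlàg trajectories), which is $q$-self-similar (for each $a>0$ the processes $(S(at))_t$ and $(a^qS(t))_t$ have the same law), with $S(1)\sim\mu$, and whose coordinates are a.s. nonnegative and nondecreasing in $t$. Assume that $S$ has zero drift, that is, $\int\min(1,\|x\|)\,\nu(dx)<\infty$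 and $\hat\mu(z)=\exp\big\{\int_{\mathbb R^d}(e^{i\langle x,z\rangle}-1)\,\nu(dx)\big\}$ for all $z\in\mathbb R^d$. Then for every $t>0$ the law of $S(t)$ is infinitely divisible without Gaussian part, with Lévy measure $$\nu(E,t)=\int_{S_+^{d-1}}\int_0^\infty \mathbf 1_E(rw)\,\frac{e^{-\beta(w)rt^{-q}}}{r^{\alpha+1}}\,t^{\alpha q}\,dr\,\lambda(dw).$$ Moreover, for $u>0$ let $$g(E,u)=\int_{S_+^{d-1}}\int_0^\infty \mathbf 1_E(rw)\,e^{-\beta(w)ru^{-q}}\,q\,u^{\alpha q-1}\,\frac{\beta(w)ru^{-q}+\alpha}{r^{\alpha+1}}\,dr\,\lambda(dw).$$ Then $g$ is the differential Lévy measure of $S$: the $g(\cdot,u)$ form a measurable family of measures carried by $\mathbb R^d_+\setminus\{0\}$ with $\int_{\|x\|\le 1}\|x\|\,g(dx,u)<\infty$ for almost all $u>0$, and for all $t>0$ and $z\in\mathbb R^d$ one has $\int_0^t\int\min(1,\|x\|)\,g(dx,u)\,du<\infty$ and $$\mathbb E\,e^{i\langle z,S(t)\rangle}=\exp\Big\{\int_0^t\int_{\mathbb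 R_+^d}\big(e^{i\langle x,z\rangle}-1\big)\,g(dx,u)\,du\Big\}.$$ -/

import Mathlib

open MeasureTheory ProbabilityTheory Set Filter Topology
open scoped NNReal ENNReal

namespace SatoETS

/-- Euclidean space `ℝ^d`. -/
abbrev Euc (d : ℕ) : Type := EuclideanSpace ℝ (Fin d)

/-- The unit sphere `S^{d-1}` of `ℝ^d`. -/
abbrev Sph (d : ℕ) : Type := Metric.sphere (0 : Euc d) 1

/-- The closed positive orthant `ℝ_+^d`. -/
def orthant (d : ℕ) : Set (Euc d) := {x | ∀ i, 0 ≤ x i}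

/-- `S_+^{d-1}`: the points of the unit sphere with nonnegative coordinates. -/
def posSphere (d : ℕ) : Set (Sph d) := {w | (w : Euc d) ∈ orthant d}

/-! ### Measures in polar coordinates -/

/-- The measure `E ↦ ∫_{S^{d-1}} ∫_0^∞ 1_E(r w) f(w, r) dr lam(dw)` on `ℝ^d`,
see `polarMeasure_apply`. -/
noncomputable def polarMeasure {d : ℕ} (lam : Measure (Sph d)) (f : Sph d → ℝ → ℝ) :
    Measure (Euc d) :=
  ((lam.prod (volume.restrict (Ioi (0 : ℝ)))).withDensity
    (fun p => ENNReal.ofReal (f p.1 p.2))).map (fun p => p.2 • (p.1 : Euc d))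

theorem polarMeasure_apply {d : ℕ} (lam : Measure (Sph d)) [IsFiniteMeasure lam]
    (f : Sph d → ℝ → ℝ) (hf : Measurable (fun p : Sph d × ℝ => f p.1 p.2))
    {B : Set (Euc d)} (hB : MeasurableSet B) :
    polarMeasure lam f B = ∫⁻ w, (∫⁻ r in Ioi (0 : ℝ),
      B.indicator (fun _ => (1 : ℝ≥0∞)) (r • (w : Euc d)) * ENNReal.ofReal (f w r)) ∂lam := by
  have hm : Measurable (fun p : Sph d × ℝ => p.2 • (p.1 : Euc d)) := by fun_prop
  have hi : Measurable (B.indicator (fun _ => (1 : ℝ≥0∞))) := measurable_const.indicator hB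
  rw [polarMeasure, Measure.map_apply hm hB, withDensity_apply _ (hm hB),
    ← lintegral_indicator (hm hB), ← lintegral_prod
      (fun p : Sph d × ℝ => B.indicator (fun _ => (1 : ℝ≥0∞)) (p.2 • (p.1 : Euc d)) *
        ENNReal.ofReal (f p.1 p.2))
      ((hi.comp hm).mul (ENNReal.measurable_ofReal.comp hf)).aemeasurable]
  congr 1
  ext p
  by_cases h : p.2 • (p.1 : Euc d) ∈ B <;> simp [Set.indicator, h]

/-! ### Infinitely divisible laws and their Lévy measures -/

/-- The `n`-fold convolution power of a measure. -/
noncomputable def convPow {d : ℕ} (ρ : Measure (Euc d)) : ℕ → Measure (Euc d)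
  | 0 => Measure.dirac 0
  | n + 1 => (convPow ρ n).conv ρ

/-- Infinite divisibility: `μ` is, for every `n ≥ 1`, the `n`-fold convolution power of some
probability measure. -/
def InfDivisible {d : ℕ} (μ : Measure (Euc d)) : Prop :=
  ∀ n : ℕ, 0 < n → ∃ ρ : Measure (Euc d), IsProbabilityMeasure ρ ∧ μ = convPow ρ n

/-- `ν` is a Lévy measure: `ν {0} = 0` and `∫ min(1, ‖x‖²) ν(dx) < ∞`. -/
def IsLevyMeasure {d : ℕ} (ν : Measure (Euc d)) : Prop :=
  ν {0} = 0 ∧ ∫⁻ x, min 1 (‖x‖ₑ ^ 2) ∂ν < ∞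

/-- `μ` is an infinitely divisible probability measure without Gaussian part and with Lévy
measure `ν`: for some `γ`, the Lévy-Khintchine formula
`μ̂(z) = exp (i⟨γ, z⟩ + ∫ (e^{i⟨x, z⟩} - 1 - i⟨x, z⟩ 1_{‖x‖ ≤ 1}) ν(dx))` holds. -/
structure HasLevyMeasure {d : ℕ} (μ ν : Measure (Euc d)) : Prop where
  isProb : IsProbabilityMeasure μ
  infDivisible : InfDivisible μ
  isLevy : IsLevyMeasure ν
  levyKhintchine : ∃ γ : Euc d, ∀ z : Euc d,
    charFun μ z = Complex.exp (((inner ℝ γ z : ℝ) : ℂ) * Complex.I +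
      ∫ x, (Complex.exp (((inner ℝ x z : ℝ) : ℂ) * Complex.I) - 1 -
        (Metric.closedBall (0 : Euc d) 1).indicator
          (fun y => ((inner ℝ y z : ℝ) : ℂ) * Complex.I) x) ∂ν)

/-- The law `μ` with Lévy measure `ν` has drift `b`: the jumps are of finite variation, that is
`∫ min(1, ‖x‖) ν(dx) < ∞`, and `μ̂(z) = exp (i⟨b, z⟩ + ∫ (e^{i⟨x, z⟩} - 1) ν(dx))`. -/
structure HasDrift {d : ℕ} (μ ν : Measure (Euc d)) (b : Euc d) : Prop where
  finiteVariation : ∫⁻ x, min 1 ‖x‖ₑ ∂ν < ∞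
  charFun_eq : ∀ z : Euc d,
    charFun μ z = Complex.exp (((inner ℝ b z : ℝ) : ℂ) * Complex.I +
      ∫ x, (Complex.exp (((inner ℝ x z : ℝ) : ℂ) * Complex.I) - 1) ∂ν)

/-! ### Exponential tempered stable laws -/

/-- The measure with radial density `e^{-β(w) r} / r^{α+1}` over `lam`. -/
noncomputable def etsLevyMeasure {d : ℕ} (α : ℝ) (β : Sph d → ℝ) (lam : Measure (Sph d)) :
    Measure (Euc d) :=
  polarMeasure lam (fun w r => Real.exp (-β w * r) / r ^ (α + 1))

/-- `μ ∼ ETαS(α, β, lam)`. -/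
structure IsETS {d : ℕ} (α : ℝ) (β : Sph d → ℝ) (lam : Measure (Sph d))
    (μ : Measure (Euc d)) : Prop where
  alpha_nonneg : 0 ≤ α
  alpha_lt_two : α < 2
  beta_measurable : Measurable β
  beta_pos : ∀ w, 0 < β w
  lam_finite : IsFiniteMeasure lam
  hasLevyMeasure : HasLevyMeasure μ (etsLevyMeasure α β lam)

/-! ### Additive processes, Sato processes and Sato subordinators -/

variable {Ω : Type*} [MeasurableSpace Ω]

/-- Additive process: it starts at `0`, has independent increments, is stochastically continuous
and has almost surely càdlàg trajectories. -/
structure IsAdditiveProcess {d : ℕ} (S : ℝ≥0 → Ω → Euc d) (P : Measure Ω) : Prop where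
  measurable : ∀ t, Measurable (S t)
  start_zero : ∀ᵐ ω ∂P, S 0 ω = 0
  indepIncrements : HasIndepIncrements S P
  stochContinuous : ∀ t, TendstoInMeasure P S (𝓝 t) (S t)
  cadlag : ∀ᵐ ω ∂P, ∀ t, ContinuousWithinAt (fun s => S s ω) (Ici t) t ∧
    ∃ l, Tendsto (fun s => S s ω) (𝓝[<] t) (𝓝 l)

/-- `S` is `q`-self-similar: for each `a > 0`, the processes `(S(a t))_t` and `(a^q S(t))_t` have
the same law on path space. -/
def SelfSimilar {d : ℕ} (q : ℝ) (S : ℝ≥0 → Ω → Euc d) (P : Measure Ω) : Prop :=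
  ∀ a : ℝ≥0, 0 < a →
    IdentDistrib (fun ω t => S (a * t) ω) (fun ω t => ((a : ℝ) ^ q) • S t ω) P P

/-- A Sato process with exponent `q` associated with the law `μ`: a `q`-self-similar additive
process with `S(1) ∼ μ`. -/
structure IsSatoProcess {d : ℕ} (q : ℝ) (μ : Measure (Euc d)) (S : ℝ≥0 → Ω → Euc d)
    (P : Measure Ω) : Prop where
  q_pos : 0 < q
  additive : IsAdditiveProcess S P
  selfSimilar : SelfSimilar q S P
  law_one : P.map (S 1) = μ

/-- A Sato subordinator: a Sato process whose coordinates have almost surely nonnegative and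
nondecreasing trajectories. -/
structure IsSatoSubordinator {d : ℕ} (q : ℝ) (μ : Measure (Euc d)) (S : ℝ≥0 → Ω → Euc d)
    (P : Measure Ω) : Prop where
  sato : IsSatoProcess q μ S P
  nonneg : ∀ᵐ ω ∂P, ∀ i t, 0 ≤ S t ω i
  monotone : ∀ᵐ ω ∂P, ∀ i, Monotone (fun t => S t ω i)

/-- `g` is a differential Lévy measure of the process `S` with zero drift: `g(·, u)`, `u > 0`, is a
measurable family of measures carried by `ℝ_+^d ∖ {0}`, with `∫_{‖x‖ ≤ 1} ‖x‖ g(dx, u) < ∞` for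
almost all `u`, and for all `t > 0`
`E e^{i⟨z, S(t)⟩} = exp (∫_0^t ∫_{ℝ_+^d} (e^{i⟨x, z⟩} - 1) g(dx, u) du)`,
where the double integral converges absolutely (`integrable`). -/
structure IsDifferentialLevyMeasure {d : ℕ} (S : ℝ≥0 → Ω → Euc d) (P : Measure Ω)
    (g : ℝ → Measure (Euc d)) : Prop where
  measurable : ∀ B, MeasurableSet B → Measurable (fun u : Ioi (0 : ℝ) => g u B)
  carrier : ∀ u, 0 < u → g u (orthant d \ {0})ᶜ = 0
  smallJumps : ∀ᵐ u ∂(volume.restrict (Ioi (0 : ℝ))),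
    ∫⁻ x in Metric.closedBall (0 : Euc d) 1, ‖x‖ₑ ∂(g u) < ∞
  integrable : ∀ t : ℝ, 0 < t → ∫⁻ u in Ioc 0 t, (∫⁻ x, min 1 ‖x‖ₑ ∂(g u)) < ∞
  charFun_eq : ∀ t : ℝ≥0, 0 < t → ∀ z : Euc d,
    charFun (P.map (S t)) z = Complex.exp (∫ u in Ioc (0 : ℝ) (t : ℝ), (∫ x in orthant d,
      (Complex.exp (((inner ℝ x z : ℝ) : ℂ) * Complex.I) - 1) ∂(g u)))

/-! ### The two explicit measures -/

/-- The measure with radial density `e^{-β(w) r t^{-q}} t^{αq} / r^{α+1}` over `lam` on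
`S_+^{d-1}`. -/
noncomputable def satoLevyMeasure {d : ℕ} (α : ℝ) (β : Sph d → ℝ) (lam : Measure (Sph d))
    (q t : ℝ) : Measure (Euc d) :=
  polarMeasure (lam.restrict (posSphere d))
    (fun w r => Real.exp (-β w * r * t ^ (-q)) / r ^ (α + 1) * t ^ (α * q))

/-- The measure with radial density
`e^{-β(w) r u^{-q}} q u^{αq-1} (β(w) r u^{-q} + α) / r^{α+1}` over `lam` on `S_+^{d-1}`. -/
noncomputable def satoDiffLevyMeasure {d : ℕ} (α : ℝ) (β : Sph d → ℝ) (lam : Measure (Sph d))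
    (q u : ℝ) : Measure (Euc d) :=
  polarMeasure (lam.restrict (posSphere d))
    (fun w r => Real.exp (-β w * r * u ^ (-q)) * q * u ^ (α * q - 1) *
      ((β w * r * u ^ (-q) + α) / r ^ (α + 1)))

end SatoETS

namespace SatoETS

open scoped FourierTransform SchwartzMap

variable {d : ℕ}

/-! ### Exponents of laws of finite variation -/

/-! By self-similarity S(t) has the law of t^q S(1), so its exponent is ψ(t^q z), where ψ is the
exponent of μ, and its Lévy measure is the image of ν under x ↦ t^q x, computed in polar coordinates
(`satoLevyMeasure_eq_map_smul`). The restriction to S_+^{d-1} is where positivity of the paths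
enters (`levyMeasure_compl_orthant`). The n-th convolution roots ρ_n of μ also live on the orthant
and have exponent ψ/n; by Fourier inversion, n(ρ_n - δ_0) tends to ν against smooth compactly
supported functions. A bump f supported off the orthant has ∫ f dρ_n = 0 and f(0) = 0, hence ∫ f dν
= 0. As the radial density is positive, λ is null outside S_+^{d-1}.

For fixed (w, r), the density of g(·, u) is the u-derivative of that of ν(·, u), which tends to 0 as
u ↓ 0. By Tonelli, ∫_0^t g(·, u) du = ν(·, t) (`lintegral_satoDiffLevyMeasure`), so the claims on g
follow from the finite variation of ν(·, t) and Fubini. -/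

/-- The exponent `∫ (e^{i⟨x, z⟩} - 1) ν(dx)`. -/
noncomputable def jumpExponent (ν : Measure (Euc d)) (z : Euc d) : ℂ :=
  ∫ x, (Complex.exp (((inner ℝ x z : ℝ) : ℂ) * Complex.I) - 1) ∂ν

theorem integrable_min_one_norm {ν : Measure (Euc d)} (h : ∫⁻ x, min 1 ‖x‖ₑ ∂ν < ∞) :
    Integrable (fun x => min 1 ‖x‖) ν := by
  refine ⟨by fun_prop, ?_⟩
  rw [hasFiniteIntegral_iff_enorm]
  refine lt_of_le_of_lt (lintegral_mono fun x => ?_) h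
  rw [Real.enorm_eq_ofReal (by positivity)]
  refine le_min ?_ ?_
  · exact ENNReal.ofReal_le_one.2 (min_le_left _ _)
  · rw [← ofReal_norm]
    exact ENNReal.ofReal_le_ofReal (min_le_right _ _)

/-- Merges the bounds 2 and ‖x‖‖z‖. Growth only linear in z keeps the exponent integrable against
Schwartz functions. -/
theorem norm_cexp_inner_sub_one_le (x z : Euc d) :
    ‖Complex.exp (((inner ℝ x z : ℝ) : ℂ) * Complex.I) - 1‖ ≤ (2 + ‖z‖) * min 1 ‖x‖ := by
  have h1 : ‖Complex.exp (((inner ℝ x z : ℝ) : ℂ) * Complex.I) - 1‖ ≤ ‖x‖ * ‖z‖ := by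
    rw [mul_comm (((inner ℝ x z : ℝ) : ℂ))]
    exact Real.norm_exp_I_mul_ofReal_sub_one_le.trans (norm_inner_le_norm x z)
  have h2 : ‖Complex.exp (((inner ℝ x z : ℝ) : ℂ) * Complex.I) - 1‖ ≤ 2 := by
    refine (norm_sub_le _ _).trans ?_
    rw [Complex.norm_exp_ofReal_mul_I, norm_one]
    norm_num
  rcases le_total 1 ‖x‖ with h | h
  · rw [min_eq_left h]
    linarith [norm_nonneg z]
  · rw [min_eq_right h]
    nlinarith [norm_nonneg z, norm_nonneg x]

theorem integrable_cexp_inner_sub_one {ν : Measure (Euc d)}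
    (hν : Integrable (fun x => min 1 ‖x‖) ν) (z : Euc d) :
    Integrable (fun x => Complex.exp (((inner ℝ x z : ℝ) : ℂ) * Complex.I) - 1) ν :=
  (hν.const_mul (2 + ‖z‖)).mono' (by fun_prop)
    (ae_of_all _ fun x => norm_cexp_inner_sub_one_le x z)

theorem norm_jumpExponent_le {ν : Measure (Euc d)}
    (hν : Integrable (fun x => min 1 ‖x‖) ν) (z : Euc d) :
    ‖jumpExponent ν z‖ ≤ (2 + ‖z‖) * ∫ x, min 1 ‖x‖ ∂ν := by
  rw [← integral_const_mul]
  exact norm_integral_le_of_norm_le (hν.const_mul _)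
    (ae_of_all _ fun x => norm_cexp_inner_sub_one_le x z)

theorem continuous_jumpExponent {ν : Measure (Euc d)}
    (hν : Integrable (fun x => min 1 ‖x‖) ν) : Continuous (jumpExponent ν) := by
  rw [continuous_iff_continuousAt]
  intro z₀
  refine continuousAt_of_dominated (bound := fun x => (2 + (‖z₀‖ + 1)) * min 1 ‖x‖)
    (Eventually.of_forall fun z => by fun_prop) ?_ (hν.const_mul _)
    (ae_of_all _ fun x => by fun_prop)
  filter_upwards [Metric.ball_mem_nhds z₀ one_pos] with z hz
  refine ae_of_all _ fun x => (norm_cexp_inner_sub_one_le x z).trans ?_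
  gcongr
  have := norm_le_norm_add_norm_sub' z z₀
  rw [Metric.mem_ball, dist_eq_norm] at hz
  linarith

theorem re_jumpExponent_nonpos {ν : Measure (Euc d)}
    (hν : Integrable (fun x => min 1 ‖x‖) ν) (z : Euc d) : (jumpExponent ν z).re ≤ 0 := by
  have := integral_re (𝕜 := ℂ) (integrable_cexp_inner_sub_one hν z)
  change _ = (jumpExponent ν z).re at this
  rw [← this]
  refine integral_nonpos fun x => ?_
  have h := Complex.re_le_norm (Complex.exp (((inner ℝ x z : ℝ) : ℂ) * Complex.I))
  rw [Complex.norm_exp_ofReal_mul_I] at h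
  simpa using h

theorem jumpExponent_zero (ν : Measure (Euc d)) : jumpExponent ν 0 = 0 := by
  simp [jumpExponent]

theorem jumpExponent_eq_charFun_sub_one (ρ : Measure (Euc d)) [IsProbabilityMeasure ρ]
    (z : Euc d) : jumpExponent ρ z = charFun ρ z - 1 := by
  rw [jumpExponent, integral_sub _ (integrable_const _), charFun_apply]
  · simp
  · refine (integrable_const (1 : ℝ)).mono' (by fun_prop) (ae_of_all _ fun x => ?_)
    rw [Complex.norm_exp_ofReal_mul_I]

theorem integrable_linear_mul_norm_schwartz (h : 𝓢(Euc d, ℂ)) :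
    Integrable (fun z : Euc d => (2 + 2 * Real.pi * ‖z‖) * ‖h z‖) := by
  have h1 := (h.integrable (μ := volume)).norm.const_mul 2
  have h2 := (h.integrable_pow_mul volume 1).const_mul (2 * Real.pi)
  refine (h1.add h2).congr (ae_of_all _ fun z => ?_)
  simp only [Pi.add_apply, pow_one]
  ring

/-- Fubini's theorem for the inverse Fourier transform of a Schwartz function. -/
theorem integral_mul_jumpExponent {ν : Measure (Euc d)} [SFinite ν]
    (hν : Integrable (fun x => min 1 ‖x‖) ν) (h : 𝓢(Euc d, ℂ)) :
    ∫ z, h z * jumpExponent ν ((2 * Real.pi) • z) =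
      ∫ x, (𝓕⁻ (h : Euc d → ℂ) x - 𝓕⁻ (h : Euc d → ℂ) 0) ∂ν := by
  have hexp : ∀ x, Integrable (fun z : Euc d =>
      Complex.exp (((2 * Real.pi * inner ℝ z x : ℝ) : ℂ) * Complex.I) * h z) := fun x => by
    refine h.integrable.norm.mono' ?_ (ae_of_all _ fun z => ?_)
    · exact (Continuous.mul (by fun_prop) h.continuous).aestronglyMeasurable
    · rw [norm_mul, Complex.norm_exp_ofReal_mul_I, one_mul]
  -- Subtracting the value at 0 produces the factor e^{i⟨x, ·⟩} - 1, integrable even if ν is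
  -- infinite near 0.
  have key : ∀ x, 𝓕⁻ (h : Euc d → ℂ) x - 𝓕⁻ (h : Euc d → ℂ) 0 =
      ∫ z, h z * (Complex.exp (((inner ℝ x ((2 * Real.pi) • z) : ℝ) : ℂ) * Complex.I) - 1) := by
    intro x
    rw [Real.fourierInv_eq', Real.fourierInv_eq']
    simp only [smul_eq_mul]
    rw [← integral_sub (hexp x) (hexp 0)]
    congr 1
    ext z
    simp only [inner_zero_right, mul_zero, Complex.ofReal_zero, zero_mul, Complex.exp_zero,
      inner_smul_right, real_inner_comm x z]
    ring
  simp_rw [key, jumpExponent, ← integral_const_mul]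
  rw [integral_integral_swap]
  refine ((integrable_linear_mul_norm_schwartz h).mul_prod hν).mono' ?_ (ae_of_all _ fun p => ?_)
  · refine Continuous.aestronglyMeasurable ?_
    exact (h.continuous.comp continuous_fst).mul (by fun_prop)
  · have := norm_cexp_inner_sub_one_le p.2 ((2 * Real.pi) • p.1)
    rw [norm_smul, Real.norm_of_nonneg (by positivity)] at this
    simp only [Function.uncurry, norm_mul]
    calc _ ≤ ‖h p.1‖ * ((2 + 2 * Real.pi * ‖p.1‖) * min 1 ‖p.2‖) := by gcongr
      _ = _ := by ring

/-! ### Convolution roots -/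

theorem isProbabilityMeasure_convPow (ρ : Measure (Euc d)) [IsProbabilityMeasure ρ] (n : ℕ) :
    IsProbabilityMeasure (convPow ρ n) := by
  induction n with
  | zero => rw [convPow]; infer_instance
  | succ n ih => rw [convPow]; infer_instance

theorem charFun_convPow (ρ : Measure (Euc d)) [IsProbabilityMeasure ρ] (n : ℕ) (z : Euc d) :
    charFun (convPow ρ n) z = charFun ρ z ^ n := by
  induction n with
  | zero => simp [convPow]
  | succ n ih =>
    have := isProbabilityMeasure_convPow ρ n
    rw [convPow, charFun_conv, ih, pow_succ]

/-- If all independent summands lie in A, so does their sum. At least one summand is needed, since 0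
may lie outside A. -/
theorem pow_measure_le_convPow (ρ : Measure (Euc d)) [IsProbabilityMeasure ρ] {A : Set (Euc d)}
    (hA : MeasurableSet A) (hadd : ∀ x ∈ A, ∀ y ∈ A, x + y ∈ A) (n : ℕ) :
    ρ A ^ (n + 1) ≤ convPow ρ (n + 1) A := by
  induction n with
  | zero => simp [convPow, Measure.dirac_zero_conv]
  | succ n ih =>
    have := isProbabilityMeasure_convPow ρ (n + 1)
    rw [convPow, pow_succ, Measure.conv, Measure.map_apply (by fun_prop) hA]
    calc ρ A ^ (n + 1) * ρ A ≤ convPow ρ (n + 1) A * ρ A := by gcongr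
      _ = ((convPow ρ (n + 1)).prod ρ) (A ×ˢ A) := (Measure.prod_prod _ _).symm
      _ ≤ _ := measure_mono fun p hp => hadd _ hp.1 _ hp.2

theorem measurableSet_orthant : MeasurableSet (orthant d) := by
  have : orthant d = ⋂ i, {x : Euc d | 0 ≤ x i} := by ext; simp [orthant]
  rw [this]
  exact MeasurableSet.iInter fun i => measurableSet_le measurable_const (by fun_prop)

theorem isClosed_orthant : IsClosed (orthant d) := by
  have : orthant d = ⋂ i, {x : Euc d | 0 ≤ x i} := by ext; simp [orthant]
  rw [this]
  exact isClosed_iInter fun i => isClosed_le continuous_const (by fun_prop)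

/-- The complement of the orthant is not stable under addition, but it is the union of the
half-spaces x_i < 0, which are. -/
theorem compl_orthant_null_of_convPow {ρ : Measure (Euc d)} [IsProbabilityMeasure ρ] {n : ℕ}
    (h : convPow ρ (n + 1) (orthant d)ᶜ = 0) : ρ (orthant d)ᶜ = 0 := by
  have hU : (orthant d)ᶜ = ⋃ i, {x : Euc d | x i < 0} := by ext; simp [orthant]
  rw [hU, measure_iUnion_null_iff] at h ⊢
  intro i
  have h1 := pow_measure_le_convPow ρ (A := {x : Euc d | x i < 0})
    (measurableSet_lt (by fun_prop) measurable_const)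
    (fun x hx y hy => by simpa using add_neg hx hy) n
  rw [h i] at h1
  exact pow_eq_zero_iff (Nat.succ_ne_zero n) |>.1 (le_antisymm h1 zero_le)

theorem finite_setOf_pow_eq_one (n : ℕ) : {w : ℂ | w ^ (n + 1) = 1}.Finite := by
  refine (Polynomial.nthRoots (n + 1) (1 : ℂ)).toFinset.finite_toSet.subset fun w hw => ?_
  simpa [Polynomial.mem_nthRoots] using hw

/-- The convolution roots of `μ = exp ψ` have characteristic function `exp (ψ / n)`. -/
theorem charFun_root {ρ ν : Measure (Euc d)} [IsProbabilityMeasure ρ] {n : ℕ}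
    (hν : Integrable (fun x => min 1 ‖x‖) ν)
    (h : ∀ z, charFun (convPow ρ (n + 1)) z = Complex.exp (jumpExponent ν z)) (z : Euc d) :
    charFun ρ z = Complex.exp (jumpExponent ν z / (n + 1 : ℕ)) := by
  set f : Euc d → ℂ := fun z => charFun ρ z * Complex.exp (-(jumpExponent ν z / (n + 1 : ℕ)))
    with hf
  have hc : Continuous f := by
    have := continuous_jumpExponent hν
    have := continuous_charFun (μ := ρ)
    fun_prop
  have hpow : ∀ z, f z ^ (n + 1) = 1 := fun z => by
    rw [hf]
    simp only
    rw [mul_pow, ← charFun_convPow, h, ← Complex.exp_nat_mul, ← Complex.exp_add]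
    convert Complex.exp_zero using 2
    have : ((n + 1 : ℕ) : ℂ) ≠ 0 := by exact_mod_cast Nat.succ_ne_zero n
    field_simp
    ring
  -- A continuous map from a connected space to the finite set of roots of unity is constant; this
  -- selects the right branch of the root.
  have hconst : f z = f 0 := isPreconnected_univ.constant_of_mapsTo
    (finite_setOf_pow_eq_one n).isDiscrete hc.continuousOn (fun z _ => hpow z)
    (mem_univ z) (mem_univ 0)
  have h0 : f 0 = 1 := by simp [hf, jumpExponent_zero]
  rw [h0] at hconst
  simp only [hf] at hconst
  rw [Complex.exp_neg] at hconst
  exact eq_of_div_eq_one (by rwa [div_eq_mul_inv])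

/-- Mean value inequality on the convex half-plane Re ≤ 0, where |exp'| ≤ 1. It bounds n(e^{ψ/n} -
1) by |ψ| uniformly in n. -/
theorem norm_cexp_sub_one_le_of_re_nonpos {w : ℂ} (hw : w.re ≤ 0) :
    ‖Complex.exp w - 1‖ ≤ ‖w‖ := by
  have := (convex_halfSpace_re_le 0).norm_image_sub_le_of_norm_hasDerivWithin_le (C := 1)
    (f := Complex.exp) (f' := Complex.exp) (x := 0) (y := w)
    (fun x _ => (Complex.hasDerivAt_exp x).hasDerivWithinAt)
    (fun x hx => by rw [Complex.norm_exp]; exact Real.exp_le_one_iff.2 hx) (by simp) hw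
  simpa using this

theorem tendsto_nat_mul_cexp_div_sub_one (w : ℂ) :
    Tendsto (fun n : ℕ => ((n + 1 : ℕ) : ℂ) * (Complex.exp (w / (n + 1 : ℕ)) - 1)) atTop (𝓝 w) := by
  have h1 : HasDerivAt (fun t : ℂ => Complex.exp (w * t)) w 0 := by
    have := ((hasDerivAt_id (0 : ℂ)).const_mul w).cexp
    simpa using this
  rw [hasDerivAt_iff_tendsto_slope_zero] at h1
  have h2 : Tendsto (fun n : ℕ => (((n + 1 : ℕ) : ℂ))⁻¹) atTop (𝓝[≠] 0) := by
    refine tendsto_nhdsWithin_iff.2 ⟨?_, Eventually.of_forall fun n => ?_⟩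
    · exact (tendsto_inv_atTop_nhds_zero_nat (𝕜 := ℂ)).comp (tendsto_add_atTop_nat 1)
    · simp only [mem_compl_iff, mem_singleton_iff, inv_eq_zero]
      exact_mod_cast Nat.succ_ne_zero n
  refine (h1.comp h2).congr fun n => ?_
  simp [div_eq_mul_inv]

/-- A Lévy measure of finite variation of an infinitely divisible law on the orthant with zero
drift is carried by the orthant. -/
theorem levyMeasure_compl_orthant {μ ν : Measure (Euc d)} [SFinite ν] (hμ : InfDivisible μ)
    (hμ0 : μ (orthant d)ᶜ = 0) (hν : Integrable (fun x => min 1 ‖x‖) ν)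
    (hchar : ∀ z, charFun μ z = Complex.exp (jumpExponent ν z)) : ν (orthant d)ᶜ = 0 := by
  choose ρ hρ using fun n : ℕ => hμ (n + 1) n.succ_pos
  have : ∀ n, IsProbabilityMeasure (ρ n) := fun n => (hρ n).1
  have hρ0 : ∀ n, ρ n (orthant d)ᶜ = 0 := fun n =>
    compl_orthant_null_of_convPow ((hρ n).2 ▸ hμ0)
  have hroot : ∀ n z, charFun (ρ n) z = Complex.exp (jumpExponent ν z / (n + 1 : ℕ)) := fun n =>
    charFun_root hν fun z => by rw [← (hρ n).2]; exact hchar z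
  refine measure_null_of_locally_null _ fun x hx => ?_
  obtain ⟨f, hfs, hfc, hfd, hfr, hfx⟩ := exists_contDiff_tsupport_subset (n := ⊤)
    (isClosed_orthant.isOpen_compl.mem_nhds hx)
  have hf0 : ∀ y ∈ orthant d, f y = 0 := fun y hy => by
    by_contra h
    exact hfs (subset_tsupport f h) hy
  have hzero : (0 : Euc d) ∈ orthant d := fun i => by simp
  let φ : 𝓢(Euc d, ℂ) := HasCompactSupport.toSchwartzMap (f := fun y => (f y : ℂ))
    (hfc.comp_left (g := fun r : ℝ => (r : ℂ)) Complex.ofReal_zero)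
    (Complex.ofRealCLM.contDiff.comp hfd)
  have hφ : ∀ y, φ y = (f y : ℂ) := fun y => rfl
  have hinv : ∀ y, 𝓕⁻ ((𝓕 φ : 𝓢(Euc d, ℂ)) : Euc d → ℂ) y = (f y : ℂ) := fun y => by
    rw [← SchwartzMap.fourierInv_coe, FourierTransform.fourierInv_fourier_eq, hφ]
  set h := (𝓕 φ : 𝓢(Euc d, ℂ))
  -- Fourier form of ∫ (f - f(0)) dρ_n = 0.
  have hprob : ∀ n, ∫ z, h z * jumpExponent (ρ n) ((2 * Real.pi) • z) = 0 := fun n => by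
    rw [integral_mul_jumpExponent]
    · refine integral_eq_zero_of_ae ?_
      filter_upwards [measure_eq_zero_iff_ae_notMem.1 (hρ0 n)] with y hy
      rw [hinv, hinv, hf0 y (not_not.1 hy), hf0 0 hzero]
      simp
    · refine (integrable_const (1 : ℝ)).mono' (by fun_prop) (ae_of_all _ fun y => ?_)
      rw [Real.norm_of_nonneg (by positivity)]
      exact min_le_left _ _
  -- The integrands are n + 1 times those of `hprob`, so the sequence is identically 0 and its limit
  -- identifies ∫ f dν.
  have hlim : Tendsto (fun n : ℕ => ∫ z, h z * (((n + 1 : ℕ) : ℂ) *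
      (Complex.exp (jumpExponent ν ((2 * Real.pi) • z) / (n + 1 : ℕ)) - 1))) atTop
      (𝓝 (∫ z, h z * jumpExponent ν ((2 * Real.pi) • z))) := by
    have hcj := continuous_jumpExponent hν
    refine tendsto_integral_of_dominated_convergence
      (fun z => ((2 + 2 * Real.pi * ‖z‖) * ‖h z‖) * ∫ x, min 1 ‖x‖ ∂ν) (fun n => ?_) ?_ (fun n => ?_)
      (ae_of_all _ fun z => (tendsto_nat_mul_cexp_div_sub_one _).const_mul _)
    · exact (h.continuous.mul (by fun_prop)).aestronglyMeasurable
    · exact (integrable_linear_mul_norm_schwartz h).mul_const _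
    · refine ae_of_all _ fun z => ?_
      have hn : (0 : ℝ) < (n + 1 : ℕ) := by positivity
      have h1 : ‖((n + 1 : ℕ) : ℂ) *
          (Complex.exp (jumpExponent ν ((2 * Real.pi) • z) / (n + 1 : ℕ)) - 1)‖ ≤
          ‖jumpExponent ν ((2 * Real.pi) • z)‖ := by
        rw [norm_mul, Complex.norm_natCast]
        have := norm_cexp_sub_one_le_of_re_nonpos
          (w := jumpExponent ν ((2 * Real.pi) • z) / (n + 1 : ℕ)) (by
            rw [Complex.div_natCast_re]
            exact div_nonpos_of_nonpos_of_nonneg (re_jumpExponent_nonpos hν _) hn.le)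
        rw [norm_div, Complex.norm_natCast, le_div_iff₀ hn] at this
        linarith
      have h2 := norm_jumpExponent_le hν ((2 * Real.pi) • z)
      rw [norm_smul, Real.norm_of_nonneg (by positivity)] at h2
      rw [norm_mul]
      calc _ ≤ ‖h z‖ * ((2 + 2 * Real.pi * ‖z‖) * ∫ x, min 1 ‖x‖ ∂ν) := by
            gcongr; exact h1.trans h2
        _ = _ := by ring
  have hseq : ∀ n : ℕ, ∫ z, h z * (((n + 1 : ℕ) : ℂ) *
      (Complex.exp (jumpExponent ν ((2 * Real.pi) • z) / (n + 1 : ℕ)) - 1)) = 0 := fun n => by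
    have := hprob n
    simp_rw [jumpExponent_eq_charFun_sub_one, hroot] at this
    simp_rw [mul_left_comm (h _)]
    rw [integral_const_mul, this, mul_zero]
  simp_rw [hseq] at hlim
  have h3 := tendsto_nhds_unique hlim tendsto_const_nhds
  rw [integral_mul_jumpExponent hν] at h3
  simp_rw [hinv, hf0 0 hzero, Complex.ofReal_zero, sub_zero] at h3
  rw [integral_complex_ofReal, Complex.ofReal_eq_zero] at h3
  -- As 0 lies in the orthant, f vanishes on a ball of radius ε about it, so f ≤ max(1, 1/ε) min(1,
  -- ‖x‖).
  have hfint : Integrable f ν := by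
    obtain ⟨ε, hε, hball⟩ : ∃ ε > 0, ∀ y, ‖y‖ < ε → f y = 0 := by
      have : (tsupport f)ᶜ ∈ 𝓝 (0 : Euc d) :=
        (isClosed_tsupport f).isOpen_compl.mem_nhds fun h0 => hfs h0 hzero
      obtain ⟨ε, hε, hb⟩ := Metric.mem_nhds_iff.1 this
      exact ⟨ε, hε, fun y hy => image_eq_zero_of_notMem_tsupport (hb (by simpa using hy))⟩
    refine (hν.const_mul (max 1 ε⁻¹)).mono' hfd.continuous.aestronglyMeasurable
      (ae_of_all _ fun y => ?_)
    by_cases hy : ‖y‖ < ε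
    · rw [hball y hy, norm_zero]
      positivity
    · have h01 := hfr (mem_range_self y)
      rw [Real.norm_of_nonneg h01.1]
      refine h01.2.trans ?_
      rcases le_total 1 ‖y‖ with h | h
      · rw [min_eq_left h, mul_one]; exact le_max_left _ _
      · rw [min_eq_right h]
        calc (1 : ℝ) = ε⁻¹ * ε := (inv_mul_cancel₀ hε.ne').symm
          _ ≤ max 1 ε⁻¹ * ‖y‖ := by
            gcongr
            · exact le_max_right _ _
            · exact not_lt.1 hy
  rw [integral_eq_zero_iff_of_nonneg (fun y => (hfr (mem_range_self y)).1) hfint] at h3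
  refine ⟨{y | f y ≠ 0}, mem_nhdsWithin_of_mem_nhds ?_, h3⟩
  exact hfd.continuous.isOpen_preimage _ isOpen_ne |>.mem_nhds (by simp [hfx])

/-! ### Integration in polar coordinates -/

instance (lam : Measure (Sph d)) [SFinite lam] (f : Sph d → ℝ → ℝ) :
    SFinite (polarMeasure lam f) := by
  rw [polarMeasure]; infer_instance

theorem lintegral_polarMeasure_eq_lintegral_prod (lam : Measure (Sph d)) [SFinite lam]
    {f : Sph d → ℝ → ℝ} (hf : Measurable (fun p : Sph d × ℝ => f p.1 p.2))
    {h : Euc d → ℝ≥0∞} (hh : Measurable h) :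
    ∫⁻ x, h x ∂(polarMeasure lam f) =
      ∫⁻ p : Sph d × ℝ, ENNReal.ofReal (f p.1 p.2) * h (p.2 • (p.1 : Euc d))
        ∂(lam.prod (volume.restrict (Ioi (0 : ℝ)))) := by
  have hm : Measurable (fun p : Sph d × ℝ => p.2 • (p.1 : Euc d)) := by fun_prop
  rw [polarMeasure, lintegral_map hh hm, lintegral_withDensity_eq_lintegral_mul _
    hf.ennreal_ofReal (show Measurable (fun p : Sph d × ℝ => h (p.2 • (p.1 : Euc d))) by fun_prop)]
  rfl

theorem lintegral_polarMeasure (lam : Measure (Sph d)) [SFinite lam]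
    {f : Sph d → ℝ → ℝ} (hf : Measurable (fun p : Sph d × ℝ => f p.1 p.2))
    {h : Euc d → ℝ≥0∞} (hh : Measurable h) :
    ∫⁻ x, h x ∂(polarMeasure lam f) =
      ∫⁻ w, (∫⁻ r in Ioi (0 : ℝ), ENNReal.ofReal (f w r) * h (r • (w : Euc d))) ∂lam := by
  have hm : Measurable (fun p : Sph d × ℝ => p.2 • (p.1 : Euc d)) := by fun_prop
  rw [lintegral_polarMeasure_eq_lintegral_prod lam hf hh, lintegral_prod]
  exact (hf.ennreal_ofReal.mul (hh.comp hm)).aemeasurable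

theorem ae_mem_Ioi_prod (lam : Measure (Sph d)) [SFinite lam] :
    ∀ᵐ p ∂(lam.prod (volume.restrict (Ioi (0 : ℝ)))), 0 < p.2 :=
  Measure.quasiMeasurePreserving_snd.ae (ae_restrict_mem measurableSet_Ioi)

theorem lintegral_Ioi_comp_mul_left {c : ℝ} (hc : 0 < c) {h : ℝ → ℝ≥0∞} (hh : Measurable h) :
    ∫⁻ r in Ioi (0 : ℝ), h r = ENNReal.ofReal c * ∫⁻ r in Ioi (0 : ℝ), h (c * r) := by
  have hmap := Real.smul_map_volume_mul_left hc.ne'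
  rw [← lintegral_indicator measurableSet_Ioi, ← lintegral_indicator measurableSet_Ioi]
  conv_lhs => rw [← hmap]
  rw [lintegral_smul_measure, lintegral_map (hh.indicator measurableSet_Ioi) (by fun_prop),
    abs_of_pos hc, smul_eq_mul]
  congr 2
  ext r
  simp [indicator, hc]

theorem map_smul_polarMeasure (lam : Measure (Sph d)) [SFinite lam]
    {f : Sph d → ℝ → ℝ} (hf : Measurable (fun p : Sph d × ℝ => f p.1 p.2)) {c : ℝ} (hc : 0 < c) :
    (polarMeasure lam f).map (fun x => c • x) =
      polarMeasure lam (fun w r => c⁻¹ * f w (c⁻¹ * r)) := by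
  refine Measure.ext_of_lintegral _ fun h hh => ?_
  have hf' : Measurable (fun p : Sph d × ℝ => c⁻¹ * f p.1 (c⁻¹ * p.2)) :=
    (hf.comp (measurable_fst.prodMk (measurable_snd.const_mul c⁻¹))).const_mul _
  rw [lintegral_map hh (by fun_prop),
    lintegral_polarMeasure lam hf (h := fun x => h (c • x)) (by fun_prop),
    lintegral_polarMeasure lam hf' hh]
  refine lintegral_congr fun w => ?_
  have hfw : Measurable (fun r => f w r) := hf.comp measurable_prodMk_left
  rw [lintegral_Ioi_comp_mul_left (inv_pos.2 hc), ← lintegral_const_mul]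
  · refine lintegral_congr fun r => ?_
    rw [ENNReal.ofReal_mul (by positivity), mul_assoc, smul_smul, mul_inv_cancel_left₀ hc.ne']
  · fun_prop
  · fun_prop

theorem polarMeasure_congr (lam : Measure (Sph d)) [SFinite lam] {f g : Sph d → ℝ → ℝ}
    (h : ∀ w r, 0 < r → f w r = g w r) : polarMeasure lam f = polarMeasure lam g := by
  rw [polarMeasure, polarMeasure]
  congr 1
  refine withDensity_congr_ae ?_
  filter_upwards [ae_mem_Ioi_prod lam] with p hp
  rw [h _ _ hp]

theorem smul_mem_orthant_iff {r : ℝ} (hr : 0 < r) (x : Euc d) :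
    r • x ∈ orthant d ↔ x ∈ orthant d := by
  simp [orthant, hr]

theorem measurableSet_posSphere : MeasurableSet (posSphere d) :=
  measurable_subtype_coe measurableSet_orthant

theorem polarMeasure_restrict_posSphere_compl (lam : Measure (Sph d)) [SFinite lam]
    (f : Sph d → ℝ → ℝ) :
    polarMeasure (lam.restrict (posSphere d)) f (orthant d \ {0})ᶜ = 0 := by
  rw [polarMeasure, Measure.map_apply (by fun_prop)
    (measurableSet_orthant.diff (measurableSet_singleton _)).compl]
  refine withDensity_absolutelyContinuous _ _ ?_
  rw [measure_eq_zero_iff_ae_notMem]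
  filter_upwards [ae_mem_Ioi_prod (lam.restrict (posSphere d)),
    Measure.quasiMeasurePreserving_fst.ae (ae_restrict_mem measurableSet_posSphere)] with p hp hw
  simp only [mem_preimage, mem_compl_iff, not_not]
  refine ⟨(smul_mem_orthant_iff hp _).2 hw, ?_⟩
  simp [hp.ne', Metric.ne_of_mem_sphere p.1.2 one_ne_zero]

/-- An open ray from 0 lies entirely inside or outside the orthant. With a positive density, a null
complement forces a null product set whose ray factor has infinite length. -/
theorem measure_compl_posSphere_of_polarMeasure (lam : Measure (Sph d)) [SFinite lam]
    {f : Sph d → ℝ → ℝ} (hf : Measurable (fun p : Sph d × ℝ => f p.1 p.2))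
    (hpos : ∀ w r, 0 < r → 0 < f w r) (h : polarMeasure lam f (orthant d)ᶜ = 0) :
    lam (posSphere d)ᶜ = 0 := by
  have hm : Measurable (fun p : Sph d × ℝ => p.2 • (p.1 : Euc d)) := by fun_prop
  rw [polarMeasure, Measure.map_apply hm measurableSet_orthant.compl,
    withDensity_apply _ (hm measurableSet_orthant.compl),
    setLIntegral_eq_zero_iff (hm measurableSet_orthant.compl)
      hf.ennreal_ofReal] at h
  have h1 : (lam.prod (volume.restrict (Ioi (0 : ℝ)))) ((posSphere d)ᶜ ×ˢ univ) = 0 := by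
    rw [measure_eq_zero_iff_ae_notMem]
    filter_upwards [h, ae_mem_Ioi_prod lam] with p hp hp0 hmem
    have := hp (fun hmem' => hmem.1 ((smul_mem_orthant_iff hp0 _).1 hmem'))
    exact (ENNReal.ofReal_pos.2 (hpos p.1 p.2 hp0)).ne' this
  rw [Measure.prod_prod, mul_eq_zero] at h1
  simpa using h1

/-! ### Linear images and the Lévy–Khintchine formula -/

theorem map_convPow (ρ : Measure (Euc d)) [IsProbabilityMeasure ρ] (L : Euc d →L[ℝ] Euc d)
    (n : ℕ) : (convPow ρ n).map L = convPow (ρ.map L) n := by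
  induction n with
  | zero => simp [convPow, Measure.map_dirac' L.measurable]
  | succ n ih =>
    have := isProbabilityMeasure_convPow ρ n
    rw [convPow, Measure.map_conv_continuousLinearMap, ih, convPow]

theorem InfDivisible.map {μ : Measure (Euc d)} (hμ : InfDivisible μ) (L : Euc d →L[ℝ] Euc d) :
    InfDivisible (μ.map L) := by
  intro n hn
  obtain ⟨ρ, hρ, rfl⟩ := hμ n hn
  exact ⟨ρ.map L, Measure.isProbabilityMeasure_map L.measurable.aemeasurable, map_convPow ρ L n⟩

theorem jumpExponent_map_smul (ν : Measure (Euc d)) (c : ℝ) (z : Euc d) :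
    jumpExponent (ν.map (fun x => c • x)) z = jumpExponent ν (c • z) := by
  rw [jumpExponent, jumpExponent, integral_map (by fun_prop)]
  · simp [inner_smul_left, inner_smul_right]
  · exact Continuous.aestronglyMeasurable (by fun_prop)

theorem lintegral_min_one_enorm_map_smul_lt_top {ν : Measure (Euc d)}
    (hν : ∫⁻ x, min 1 ‖x‖ₑ ∂ν < ∞) (c : ℝ) :
    ∫⁻ x, min 1 ‖x‖ₑ ∂(ν.map (fun x => c • x)) < ∞ := by
  rw [lintegral_map (by fun_prop) (by fun_prop)]
  refine lt_of_le_of_lt (lintegral_mono fun x => ?_)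
    (b := ∫⁻ x, max 1 ‖c‖ₑ * min 1 ‖x‖ₑ ∂ν) ?_
  · rw [enorm_smul, mul_min, mul_one]
    exact min_le_min (le_max_left _ _) (by gcongr; exact le_max_right _ _)
  · rw [lintegral_const_mul _ (by fun_prop)]
    exact ENNReal.mul_lt_top (max_lt ENNReal.one_lt_top enorm_lt_top) hν

/-- The drift-free formula with jumps of finite variation is a Lévy–Khintchine formula. -/
theorem hasLevyMeasure_of_charFun_eq {μ ν : Measure (Euc d)} (hprob : IsProbabilityMeasure μ)
    (hdiv : InfDivisible μ) (h0 : ν {0} = 0) (hfv : ∫⁻ x, min 1 ‖x‖ₑ ∂ν < ∞)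
    (hchar : ∀ z, charFun μ z = Complex.exp (jumpExponent ν z)) : HasLevyMeasure μ ν := by
  have hν := integrable_min_one_norm hfv
  refine ⟨hprob, hdiv, ⟨h0, lt_of_le_of_lt (lintegral_mono fun x => ?_) hfv⟩, ?_⟩
  · rcases le_total 1 ‖x‖ₑ with h | h
    · rw [min_eq_left h]; exact min_le_left _ _
    · rw [min_eq_right h]
      exact (min_le_right _ _).trans (pow_le_of_le_one zero_le h two_ne_zero)
  have hball : MeasurableSet (Metric.closedBall (0 : Euc d) 1) := measurableSet_closedBall
  have hid : IntegrableOn (fun x : Euc d => x) (Metric.closedBall 0 1) ν := by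
    refine hν.integrableOn.mono' (by fun_prop) ?_
    filter_upwards [ae_restrict_mem hball] with x hx
    rw [mem_closedBall_zero_iff] at hx
    rw [min_eq_right hx]
  -- This γ cancels the truncation term.
  refine ⟨∫ x in Metric.closedBall (0 : Euc d) 1, x ∂ν, fun z => ?_⟩
  have hin : IntegrableOn (fun y : Euc d => ((inner ℝ y z : ℝ) : ℂ) * Complex.I)
      (Metric.closedBall 0 1) ν := (hid.inner_const z).ofReal.mul_const _
  rw [integral_sub (integrable_cexp_inner_sub_one hν z) (hin.integrable_indicator hball),
    integral_indicator hball, integral_mul_const, integral_complex_ofReal, hchar, jumpExponent]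
  have : ∫ x in Metric.closedBall (0 : Euc d) 1, (inner ℝ x z : ℝ) ∂ν =
      inner ℝ (∫ x in Metric.closedBall (0 : Euc d) 1, x ∂ν) z := by
    rw [real_inner_comm, ← integral_inner hid]
    simp_rw [real_inner_comm]
  rw [this, add_sub_cancel]

/-! ### The Lévy measures of the process -/

theorem measurable_ets_density {α : ℝ} {β : Sph d → ℝ} (hβ : Measurable β) :
    Measurable (fun p : Sph d × ℝ => Real.exp (-β p.1 * p.2) / p.2 ^ (α + 1)) := by
  fun_prop

/-- With c = t^q, the scaled density is c⁻¹ f(w, r/c), and c⁻¹ c^{α+1} = t^{αq}. -/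
theorem satoLevyMeasure_eq_map_smul (α : ℝ) {β : Sph d → ℝ} (hβ : Measurable β)
    (lam : Measure (Sph d)) [SFinite lam] (hlam : lam (posSphere d)ᶜ = 0) (q : ℝ) {t : ℝ}
    (ht : 0 < t) :
    satoLevyMeasure α β lam q t = (etsLevyMeasure α β lam).map (fun x => t ^ q • x) := by
  have hc : 0 < t ^ q := Real.rpow_pos_of_pos ht q
  rw [satoLevyMeasure, etsLevyMeasure,
    Measure.restrict_eq_self_of_ae_mem (s := posSphere d) (mem_ae_iff.2 hlam),
    map_smul_polarMeasure lam (measurable_ets_density hβ) hc]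
  refine polarMeasure_congr lam fun w r hr => ?_
  rw [Real.mul_rpow (inv_nonneg.2 hc.le) hr.le, Real.inv_rpow hc.le, Real.rpow_add hc,
    Real.rpow_one, mul_comm α q, Real.rpow_mul ht.le, Real.rpow_neg ht.le]
  have := Real.rpow_pos_of_pos hr (α + 1)
  have := Real.rpow_pos_of_pos hc α
  have he : -β w * r * (t ^ q)⁻¹ = -β w * ((t ^ q)⁻¹ * r) := by ring
  rw [he]
  field_simp

/-! ### The differential Lévy measure -/

theorem tendsto_exp_neg_mul_rpow_neg {k q : ℝ} (hk : 0 < k) (hq : 0 < q) :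
    Tendsto (fun u : ℝ => Real.exp (-k * u ^ (-q))) (𝓝[>] 0) (𝓝 0) := by
  refine Real.tendsto_exp_atBot.comp ?_
  exact (tendsto_rpow_neg_nhdsGT_zero (neg_lt_zero.2 hq)).const_mul_atTop_of_neg (neg_lt_zero.2 hk)

/-- For k = β(w) r and a = α this derivative is the density of g(·, u), up to the factor r^{α+1}. -/
theorem hasDerivAt_exp_neg_mul_rpow (k a q : ℝ) {u : ℝ} (hu : 0 < u) :
    HasDerivAt (fun u : ℝ => Real.exp (-k * u ^ (-q)) * u ^ (a * q))
      (Real.exp (-k * u ^ (-q)) * q * u ^ (a * q - 1) * (k * u ^ (-q) + a)) u := by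
  have h1 := ((Real.hasDerivAt_rpow_const (p := -q) (Or.inl hu.ne')).const_mul (-k)).exp
  have h2 := Real.hasDerivAt_rpow_const (p := a * q) (Or.inl hu.ne')
  refine (h1.mul h2).congr_deriv ?_
  rw [Real.rpow_sub_one hu.ne', Real.rpow_sub_one hu.ne']
  field_simp

theorem lintegral_exp_neg_mul_rpow {k a q t : ℝ} (hk : 0 < k) (ha : 0 ≤ a) (hq : 0 < q)
    (ht : 0 < t) :
    ∫⁻ u in Ioc 0 t, ENNReal.ofReal
      (Real.exp (-k * u ^ (-q)) * q * u ^ (a * q - 1) * (k * u ^ (-q) + a)) =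
      ENNReal.ofReal (Real.exp (-k * t ^ (-q)) * t ^ (a * q)) := by
  -- The indicator corrects the value at 0: for a = 0 the bare formula gives 1 there under Lean's
  -- conventions for powers of 0, while the limit is 0.
  set F := (Ioi (0 : ℝ)).indicator (fun u : ℝ => Real.exp (-k * u ^ (-q)) * u ^ (a * q)) with hF
  set F' := fun u : ℝ => Real.exp (-k * u ^ (-q)) * q * u ^ (a * q - 1) * (k * u ^ (-q) + a)
    with hF'
  have hd : ∀ u, 0 < u → HasDerivAt F (F' u) u := fun u hu =>
    (hasDerivAt_exp_neg_mul_rpow k a q hu).congr_of_eventuallyEq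
      (by filter_upwards [Ioi_mem_nhds hu] with v hv using indicator_of_mem hv _)
  have hlim : Tendsto F (𝓝[>] 0) (𝓝 0) := by
    refine tendsto_of_tendsto_of_tendsto_of_le_of_le' tendsto_const_nhds
      (tendsto_exp_neg_mul_rpow_neg hk hq) ?_ ?_
    · filter_upwards [self_mem_nhdsWithin] with u hu
      have hu : 0 < u := hu
      rw [hF, indicator_of_mem (mem_Ioi.2 hu)]
      positivity
    · filter_upwards [Ioc_mem_nhdsGT one_pos] with u hu
      rw [hF, indicator_of_mem (mem_Ioi.2 hu.1)]
      exact mul_le_of_le_one_right (Real.exp_pos _).le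
        (Real.rpow_le_one hu.1.le hu.2 (by positivity))
  have hF0 : F 0 = 0 := indicator_of_notMem (lt_irrefl _) _
  have hcont : ContinuousOn F (Icc 0 t) := by
    intro x hx
    rcases hx.1.eq_or_lt with rfl | h
    · have : ContinuousWithinAt F (Ici 0) 0 := by
        rw [← continuousWithinAt_Ioi_iff_Ici, ContinuousWithinAt, hF0]
        exact hlim
      exact this.mono Icc_subset_Ici_self
    · exact (hd x h).continuousAt.continuousWithinAt
  have hnn : ∀ u, 0 < u → 0 ≤ F' u := fun u hu => by positivity
  -- Integrability near 0 comes from the sign of the derivative, without estimates.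
  have hint := intervalIntegral.integrableOn_deriv_of_nonneg hcont (fun x hx => hd x hx.1)
    (fun x hx => hnn x hx.1)
  have hftc := intervalIntegral.integral_eq_sub_of_hasDerivAt_of_le ht.le hcont
    (fun x hx => hd x hx.1) ((intervalIntegrable_iff_integrableOn_Ioc_of_le ht.le).2 hint)
  rw [intervalIntegral.integral_of_le ht.le, hF0, sub_zero, hF,
    indicator_of_mem (mem_Ioi.2 ht)] at hftc
  rw [← hftc, ofReal_integral_eq_lintegral_ofReal hint]
  filter_upwards [ae_restrict_mem measurableSet_Ioc] with u hu using hnn u hu.1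

theorem measurable_satoDiff_density (α q : ℝ) {β : Sph d → ℝ} (hβ : Measurable β) :
    Measurable (fun p : ℝ × Sph d × ℝ => Real.exp (-β p.2.1 * p.2.2 * p.1 ^ (-q)) * q *
      p.1 ^ (α * q - 1) * ((β p.2.1 * p.2.2 * p.1 ^ (-q) + α) / p.2.2 ^ (α + 1))) := by
  fun_prop

/-- The measures `satoDiffLevyMeasure α β lam q u` as a kernel. -/
noncomputable def satoDiffKernel (α : ℝ) (β : Sph d → ℝ) (lam : Measure (Sph d))
    [SFinite lam] (q : ℝ) : Kernel ℝ (Euc d) :=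
  ((Kernel.const ℝ ((lam.restrict (posSphere d)).prod
    (volume.restrict (Ioi (0 : ℝ))))).withDensity (fun u p => ENNReal.ofReal
      (Real.exp (-β p.1 * p.2 * u ^ (-q)) * q * u ^ (α * q - 1) *
        ((β p.1 * p.2 * u ^ (-q) + α) / p.2 ^ (α + 1))))).map
    (fun p : Sph d × ℝ => p.2 • (p.1 : Euc d))

theorem satoDiffKernel_apply (α q : ℝ) {β : Sph d → ℝ} (hβ : Measurable β)
    (lam : Measure (Sph d)) [SFinite lam] (u : ℝ) :
    satoDiffKernel α β lam q u = satoDiffLevyMeasure α β lam q u := by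
  rw [satoDiffKernel, Kernel.map_apply _ (by fun_prop), Kernel.withDensity_apply _
    (measurable_satoDiff_density α q hβ).ennreal_ofReal, Kernel.const_apply]
  rfl

theorem lintegral_satoDiffLevyMeasure {α q t : ℝ} (hα : 0 ≤ α) (hq : 0 < q) (ht : 0 < t)
    {β : Sph d → ℝ} (hβ : Measurable β) (hβ0 : ∀ w, 0 < β w) (lam : Measure (Sph d)) [SFinite lam]
    {h : Euc d → ℝ≥0∞} (hh : Measurable h) :
    ∫⁻ u in Ioc 0 t, ∫⁻ x, h x ∂(satoDiffLevyMeasure α β lam q u) =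
      ∫⁻ x, h x ∂(satoLevyMeasure α β lam q t) := by
  have hm : Measurable (fun p : Sph d × ℝ => p.2 • (p.1 : Euc d)) := by fun_prop
  have hD := (measurable_satoDiff_density α q hβ).ennreal_ofReal
  have hf : Measurable (fun p : Sph d × ℝ =>
      Real.exp (-β p.1 * p.2 * t ^ (-q)) / p.2 ^ (α + 1) * t ^ (α * q)) := by fun_prop
  rw [satoLevyMeasure, lintegral_polarMeasure_eq_lintegral_prod _ hf hh]
  have hg : ∀ u : ℝ, ∫⁻ x, h x ∂(satoDiffLevyMeasure α β lam q u) = _ := fun u =>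
    lintegral_polarMeasure_eq_lintegral_prod (lam.restrict (posSphere d))
      (f := fun w r => Real.exp (-β w * r * u ^ (-q)) * q * u ^ (α * q - 1) *
        ((β w * r * u ^ (-q) + α) / r ^ (α + 1)))
      ((measurable_satoDiff_density α q hβ).comp measurable_prodMk_left) hh
  simp_rw [hg]
  rw [lintegral_lintegral_swap]
  · refine lintegral_congr_ae ?_
    filter_upwards [ae_mem_Ioi_prod (lam.restrict (posSphere d))] with p hp
    rw [lintegral_mul_const _ (by fun_prop)]
    congr 1
    have hr : 0 ≤ (p.2 ^ (α + 1))⁻¹ := by positivity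
    have key := lintegral_exp_neg_mul_rpow (mul_pos (hβ0 p.1) hp) hα hq ht
    calc _ = ∫⁻ u in Ioc 0 t, ENNReal.ofReal (p.2 ^ (α + 1))⁻¹ * ENNReal.ofReal
            (Real.exp (-(β p.1 * p.2) * u ^ (-q)) * q * u ^ (α * q - 1) *
              (β p.1 * p.2 * u ^ (-q) + α)) := by
          refine lintegral_congr fun u => ?_
          rw [← ENNReal.ofReal_mul hr, div_eq_mul_inv, neg_mul]
          congr 1
          ring
      _ = _ := by
          rw [lintegral_const_mul _ (by fun_prop), key, ← ENNReal.ofReal_mul hr, neg_mul]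
          congr 1
          ring
  · exact (hD.mul ((hh.comp hm).comp measurable_snd)).aemeasurable

/-- Casting the time integral as a kernel composition makes Fubini available for complex integrands.
-/
theorem satoDiffKernel_comp_volume {α q t : ℝ} (hα : 0 ≤ α) (hq : 0 < q) (ht : 0 < t)
    {β : Sph d → ℝ} (hβ : Measurable β) (hβ0 : ∀ w, 0 < β w) (lam : Measure (Sph d))
    [SFinite lam] :
    satoDiffKernel α β lam q ∘ₘ volume.restrict (Ioc 0 t) = satoLevyMeasure α β lam q t := by
  refine Measure.ext_of_lintegral _ fun h hh => ?_
  rw [Measure.lintegral_bind (Kernel.measurable _).aemeasurable hh.aemeasurable]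
  simp_rw [satoDiffKernel_apply α q hβ lam]
  exact lintegral_satoDiffLevyMeasure hα hq ht hβ hβ0 lam hh

/-! ### Self-similarity -/

theorem SelfSimilar.map_eq {Ω : Type*} [MeasurableSpace Ω] {P : Measure Ω} {q : ℝ}
    {S : ℝ≥0 → Ω → Euc d} (hS : SelfSimilar q S P) (hm : Measurable (S 1)) {t : ℝ≥0}
    (ht : 0 < t) : P.map (S t) = (P.map (S 1)).map (fun x => (t : ℝ) ^ q • x) := by
  have h := ((hS t ht).comp (measurable_pi_apply (1 : ℝ≥0))).map_eq
  rw [Measure.map_map (by fun_prop) hm]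
  simpa [Function.comp_def] using h

theorem IsSatoSubordinator.measure_compl_orthant {Ω : Type*} [MeasurableSpace Ω] {P : Measure Ω}
    {q : ℝ} {μ : Measure (Euc d)} {S : ℝ≥0 → Ω → Euc d} (hS : IsSatoSubordinator q μ S P) :
    μ (orthant d)ᶜ = 0 := by
  rw [← hS.sato.law_one,
    Measure.map_apply (hS.sato.additive.measurable 1) measurableSet_orthant.compl,
    measure_eq_zero_iff_ae_notMem]
  filter_upwards [hS.nonneg] with ω hω
  simpa [orthant] using fun i => hω i 1

end SatoETS

open SatoETS in
theorem theorem3p2 {d : ℕ} {Ω : Type*} [MeasurableSpace Ω] (P : Measure Ω)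
    [IsProbabilityMeasure P] (α q : ℝ) (β : SatoETS.Sph d → ℝ) (lam : Measure (SatoETS.Sph d))
    (μ : Measure (SatoETS.Euc d)) (hμ : SatoETS.IsETS α β lam μ)
    (hdrift : SatoETS.HasDrift μ (SatoETS.etsLevyMeasure α β lam) 0)
    (S : ℝ≥0 → Ω → SatoETS.Euc d) (hS : SatoETS.IsSatoSubordinator q μ S P) :
    (∀ t : ℝ≥0, 0 < t →
      SatoETS.HasLevyMeasure (P.map (S t)) (SatoETS.satoLevyMeasure α β lam q t)) ∧
    SatoETS.IsDifferentialLevyMeasure S P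
      (fun u => SatoETS.satoDiffLevyMeasure α β lam q u) := by
  have := hμ.lam_finite
  have hβ := hμ.beta_measurable
  have hq := hS.sato.q_pos
  have hα := hμ.alpha_nonneg
  set ν := etsLevyMeasure α β lam with hνdef
  have : SFinite ν := by rw [hνdef, etsLevyMeasure]; infer_instance
  have hchar : ∀ z, charFun μ z = Complex.exp (jumpExponent ν z) := fun z => by
    rw [hdrift.charFun_eq z]
    simp [jumpExponent]
  have hν0 := levyMeasure_compl_orthant hμ.hasLevyMeasure.infDivisible hS.measure_compl_orthant
    (integrable_min_one_norm hdrift.finiteVariation) hchar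
  have hlam : lam (posSphere d)ᶜ = 0 := measure_compl_posSphere_of_polarMeasure lam
    (measurable_ets_density hβ) (fun w r hr => by positivity) hν0
  have hLevy : ∀ t : ℝ, 0 < t →
      satoLevyMeasure α β lam q t = ν.map (fun x => t ^ q • x) := fun t ht =>
    satoLevyMeasure_eq_map_smul α hβ lam hlam q ht
  have hfv : ∀ t : ℝ, 0 < t → ∫⁻ x, min 1 ‖x‖ₑ ∂(satoLevyMeasure α β lam q t) < ∞ :=
    fun t ht => by
      rw [hLevy t ht]
      exact lintegral_min_one_enorm_map_smul_lt_top hdrift.finiteVariation _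
  have hlaw : ∀ t : ℝ≥0, 0 < t → P.map (S t) = μ.map (fun x => (t : ℝ) ^ q • x) :=
    fun t ht => by
      rw [← hS.sato.law_one]
      exact hS.sato.selfSimilar.map_eq (hS.sato.additive.measurable 1) ht
  have hcharS : ∀ t : ℝ≥0, 0 < t → ∀ z, charFun (P.map (S t)) z =
      Complex.exp (jumpExponent (satoLevyMeasure α β lam q t) z) := fun t ht z => by
    rw [hlaw t ht, charFun_map_smul, hchar, hLevy t ht, jumpExponent_map_smul]
  have hcarrier := fun u => polarMeasure_restrict_posSphere_compl lam (fun w r =>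
      Real.exp (-β w * r * u ^ (-q)) * q * u ^ (α * q - 1) *
      ((β w * r * u ^ (-q) + α) / r ^ (α + 1)))
  have hint : ∀ t : ℝ, 0 < t → ∫⁻ u in Ioc 0 t,
      (∫⁻ x, min 1 ‖x‖ₑ ∂(satoDiffLevyMeasure α β lam q u)) < ∞ := fun t ht => by
    rw [lintegral_satoDiffLevyMeasure hα hq ht hβ hμ.beta_pos lam (by fun_prop)]
    exact hfv t ht
  have hmeas : ∀ B, MeasurableSet B →
      Measurable (fun u => satoDiffLevyMeasure α β lam q u B) := fun B hB => by
    simp_rw [← satoDiffKernel_apply α q hβ lam]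
    exact Kernel.measurable_coe _ hB
  refine ⟨fun t ht => ?_, ⟨fun B hB => (hmeas B hB).comp measurable_subtype_coe,
    fun u _ => hcarrier u, ?_, hint, fun t ht z => ?_⟩⟩
  · refine hasLevyMeasure_of_charFun_eq
      (Measure.isProbabilityMeasure_map (hS.sato.additive.measurable t).aemeasurable) ?_ ?_
      (hfv t ht) (hcharS t ht)
    · rw [hlaw t ht]
      exact hμ.hasLevyMeasure.infDivisible.map ((t : ℝ) ^ q • ContinuousLinearMap.id ℝ (Euc d))
    · exact measure_mono_null (by simp)
        (polarMeasure_restrict_posSphere_compl lam _)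
  -- On each (0, n] the finite double integral forces finite inner integrals for almost every u.
  · have hU : Ioi (0 : ℝ) = ⋃ n : ℕ, Ioc (0 : ℝ) n := by
      ext u
      simp only [mem_Ioi, mem_iUnion, mem_Ioc]
      exact ⟨fun hu => (exists_nat_ge u).imp fun n hn => ⟨hu, hn⟩, fun ⟨n, hn⟩ => hn.1⟩
    rw [hU, ae_restrict_iUnion_iff]
    intro n
    rcases n.eq_zero_or_pos with rfl | hn
    · simp
    have hmin : Measurable (fun u =>
        ∫⁻ x, min 1 ‖x‖ₑ ∂(satoDiffLevyMeasure α β lam q u)) := by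
      simp_rw [← satoDiffKernel_apply α q hβ lam]
      exact Measurable.lintegral_kernel (by fun_prop)
    filter_upwards [ae_lt_top hmin (hint n (by exact_mod_cast hn)).ne] with u hu
    refine lt_of_le_of_lt ?_ hu
    refine (setLIntegral_mono' measurableSet_closedBall fun x hx => ?_).trans
      (setLIntegral_le_lintegral _ _)
    rw [mem_closedBall_zero_iff] at hx
    refine le_min ?_ le_rfl
    rw [← ofReal_norm]
    exact ENNReal.ofReal_le_one.2 hx
  · rw [hcharS t ht z, jumpExponent]
    have hi := integrable_cexp_inner_sub_one (integrable_min_one_norm (hfv t ht)) z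
    have ht' : (0 : ℝ) < t := ht
    rw [← satoDiffKernel_comp_volume hα hq ht' hβ hμ.beta_pos lam,
      Measure.comp_eq_comp_const_apply] at hi ⊢
    rw [Kernel.integral_comp hi, Kernel.const_apply]
    simp_rw [satoDiffKernel_apply α q hβ lam]
    congr 2
    ext u
    -- Restricting to the orthant changes nothing, since g(·, u) is carried by it.
    rw [Measure.restrict_eq_self_of_ae_mem]
    refine mem_ae_iff.2 (measure_mono_null ?_ (hcarrier u))
    exact compl_subset_compl.2 sdiff_subset
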